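/- Let $M^{n+1}$ be a spacetime, that is, a smooth manifold of dimension $n+1$, $n\ge 2$, with a smooth Lorentzian metric $\langle\cdot,\cdot\rangle$ of signature $(-,+,\dots,+)$ and Levi-Civita connection $\nabla$, time oriented by a continuous vector field $o$ that is causal everywhere. (A tangent vector $v$ is causal if $v\neq 0$ and $\langle v,v\rangle\le 0$, timelike if $\langle v,v\rangle<0$; a causal vector is future if it lies in the same half cone as $o$. A subspace of a tangent space is spacelike if the metric is positive definite on it.) A $k$-dimensional spacelike submanifold is a smoothly embedded $k$-dimensional manifold without boundary $S\subset M$ whose tangent spaces are spacelike. Its mean curvature vector is $H=-h^{\alpha\beta}(\nabla_{e_\alpha}e_\beta)^{\perp}$, where $e_1,\dots,e_k$ is a coordinate frame of $S$, $h^{\alpha\beta}$ is the inverse of the matrix $h_{\alpha\beta}=\langle e_\alpha,e_\beta\rangle$, and $\perp$ is the component normal to $S$. $S$ satisfies the trapping condition at $p\in S$ if $H|_p$ is future timelike. A closed trapped submanifold is a nonempty compact spacelike submanifold that satisfies the trapping condition at all of its points. Theorem. Let $g:M\to\mathbb R$ be a $C^2$ function, let $k$ be a nonnegative integer, and let $Z\subset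 M$ be an open set such that at every $p\in Z$ the gradient $\nabla^a g$ is future causal and, for every $k$-dimensional spacelike subspace $W$ of the tangent space $\ker dg_p$ of the $g$-level set through $p$, the trace (with respect to the metric) of the restriction of the Hessian $\nabla_a\nabla_b g$ to $W$ is nonnegative: $h^{\alpha\beta}e_\alpha^a e_\beta^b\nabla_a\nabla_b g|_p\ge 0$ for every basis $e_1,\dots,e_k$ of $W$, with $h^{\alpha\beta}$ the inverse of the matrix $h_{\alpha\beta}=\langle e_\alpha,e_\beta\rangle$. (i) If $S\subset M$ is a $k$-dimensional spacelike submanifold and $g|_S$ has a local maximum at a point $p\in S\cap Z$, then $S$ does not satisfy the trapping condition at $p$. (ii) If $S$ is a $k$-dimensional closed trapped submanifold of $M$, then $S\not\subset Z$. -/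

import Mathlib

open Bundle Manifold
open scoped ContDiff

noncomputable section

/-- Coordinate space `ℝᵈ`. -/
abbrev Coord (d : ℕ) : Type := EuclideanSpace ℝ (Fin d)

/-- A smooth Lorentzian metric, of mostly plus signature `(-,+,…,+)`, on an `(n+1)`-dimensional
smooth manifold `M`. -/
structure LorentzianMetric (n : ℕ) (M : Type*) [TopologicalSpace M]
    [ChartedSpace (Coord (n + 1)) M] [IsManifold (𝓡 (n + 1)) ∞ M] where
  /-- The inner product `⟨u, v⟩` of two vectors tangent at `p`. -/
  inner (p : M) : TangentSpace (𝓡 (n + 1)) p →L[ℝ] TangentSpace (𝓡 (n + 1)) p →L[ℝ] ℝ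
  symm (p : M) (u v : TangentSpace (𝓡 (n + 1)) p) : inner p u v = inner p v u
  signature (p : M) : ∃ b : Module.Basis (Fin (n + 1)) ℝ (TangentSpace (𝓡 (n + 1)) p),
    ∀ i j, inner p (b i) (b j) = if i = j then (if i = 0 then -1 else 1) else 0
  contMDiff : ContMDiff (𝓡 (n + 1))
    ((𝓡 (n + 1)).prod 𝓘(ℝ, Coord (n + 1) →L[ℝ] Coord (n + 1) →L[ℝ] ℝ)) ∞
    (fun p ↦ TotalSpace.mk' (Coord (n + 1) →L[ℝ] Coord (n + 1) →L[ℝ] ℝ)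
      (E := fun p : M ↦ TangentSpace (𝓡 (n + 1)) p →L[ℝ] TangentSpace (𝓡 (n + 1)) p →L[ℝ] ℝ)
      p (inner p))

namespace LorentzianMetric

variable {n : ℕ} {M : Type*} [TopologicalSpace M] [ChartedSpace (Coord (n + 1)) M]

theorem finiteDimensional_tangentSpace (p : M) :
    FiniteDimensional ℝ (TangentSpace (𝓡 (n + 1)) p) :=
  inferInstanceAs (FiniteDimensional ℝ (Coord (n + 1)))

variable [IsManifold (𝓡 (n + 1)) ∞ M] (G : LorentzianMetric n M)

/-- A tangent vector is causal if it is nonzero and `⟨v, v⟩ ≤ 0`. -/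
def IsCausal {p : M} (v : TangentSpace (𝓡 (n + 1)) p) : Prop :=
  v ≠ 0 ∧ G.inner p v v ≤ 0

/-- A tangent vector is timelike if `⟨v, v⟩ < 0`. -/
def IsTimelike {p : M} (v : TangentSpace (𝓡 (n + 1)) p) : Prop :=
  G.inner p v v < 0

/-- A subspace of a tangent space is spacelike if the metric is positive definite on it. -/
def IsSpacelike {p : M} (W : Submodule ℝ (TangentSpace (𝓡 (n + 1)) p)) : Prop :=
  ∀ v ∈ W, v ≠ 0 → 0 < G.inner p v v

/-- The metric at `p` as a bilinear form. -/
def bilin (p : M) : LinearMap.BilinForm ℝ (TangentSpace (𝓡 (n + 1)) p) :=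
  LinearMap.mk₂ ℝ (fun u v ↦ G.inner p u v) (by simp) (by simp) (by simp) (by simp)

theorem bilin_nondegenerate (p : M) : (G.bilin p).Nondegenerate := by
  obtain ⟨b, hb⟩ := G.signature p
  have key : ∀ v, (∀ w, G.inner p v w = 0) → v = 0 := by
    intro v hv
    have hc : ∀ j, b.repr v j = 0 := by
      intro j
      have h := hv (b j)
      rw [← b.sum_repr v] at h
      simp only [map_sum, map_smul, sum_apply, smul_apply,
        hb, smul_eq_mul, mul_ite, mul_zero, Finset.sum_ite_eq', Finset.mem_univ, if_true] at h
      split_ifs at h <;> linarith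
    rw [← b.sum_repr v]
    simp [hc]
  refine ⟨fun v hv ↦ key v hv, fun v hv ↦ key v fun w ↦ ?_⟩
  rw [G.symm]
  exact hv w

/-- Raising an index: the vector `v` at `p` with `⟨v, w⟩ = ξ w` for all `w`. -/
def sharp (p : M) (ξ : TangentSpace (𝓡 (n + 1)) p →L[ℝ] ℝ) : TangentSpace (𝓡 (n + 1)) p :=
  haveI := finiteDimensional_tangentSpace (n := n) p
  ((G.bilin p).toDual (G.bilin_nondegenerate p)).symm ξ.toLinearMap

theorem inner_sharp (p : M) (ξ : TangentSpace (𝓡 (n + 1)) p →L[ℝ] ℝ)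
    (w : TangentSpace (𝓡 (n + 1)) p) : G.inner p (G.sharp p ξ) w = ξ w :=
  haveI := finiteDimensional_tangentSpace (n := n) p
  LinearMap.BilinForm.apply_toDual_symm_apply (hB := G.bilin_nondegenerate p) _ w

/-- The gradient `∇ᵃ f`. -/
def gradient (f : M → ℝ) (p : M) : TangentSpace (𝓡 (n + 1)) p :=
  G.sharp p (mfderiv (𝓡 (n + 1)) 𝓘(ℝ, ℝ) f p)

/-- The metric coefficients in the coordinates around `p` given by the chart at `p`: the pullback
of the metric to `ℝⁿ⁺¹` under the inverse of that chart. The tangent space at `q` is identified with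
`ℝⁿ⁺¹` through the chart at `q`, so that the differential at `y` of the inverse of the chart at `p`
is the derivative of the transition map from the chart at `p` to the chart at `q`, where `q` has
coordinates `y`. -/
def coordMetric (p : M) (y : Coord (n + 1)) : Coord (n + 1) →L[ℝ] Coord (n + 1) →L[ℝ] ℝ :=
  let q : M := (extChartAt (𝓡 (n + 1)) p).symm y
  let A : Coord (n + 1) →L[ℝ] Coord (n + 1) := tangentCoordChange (𝓡 (n + 1)) p q q
  let B : Coord (n + 1) →L[ℝ] Coord (n + 1) →L[ℝ] ℝ := G.inner q
  B.bilinearComp A A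

set_option synthInstance.maxHeartbeats 400000 in
/-- The Christoffel symbols of the Levi-Civita connection at `p`, in the coordinates given by the
chart at `p` (in which the tangent space at `p` is identified with `ℝⁿ⁺¹`): `Γ(u, v)` is determined
by `⟨Γ(u, v), w⟩ = ½ (∂_u ⟨v, w⟩ + ∂_v ⟨u, w⟩ - ∂_w ⟨u, v⟩)`. -/
def christoffel (p : M) (u v : Coord (n + 1)) : Coord (n + 1) :=
  let D : Coord (n + 1) →L[ℝ] Coord (n + 1) →L[ℝ] Coord (n + 1) →L[ℝ] ℝ :=
    fderiv ℝ (G.coordMetric p) (extChartAt (𝓡 (n + 1)) p p)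
  G.sharp p ((1 / 2 : ℝ) • (D u v + D v u - (D.flip u).flip v))

/-- The Hessian `∇ₐ∇ᵦ f = ∂ₐ∂ᵦ f - Γᶜₐᵦ ∂_c f` at `p`, in the coordinates given by the chart
at `p`. -/
def hessian (f : M → ℝ) (p : M) (u v : TangentSpace (𝓡 (n + 1)) p) : ℝ :=
  let F : Coord (n + 1) → ℝ := f ∘ (extChartAt (𝓡 (n + 1)) p).symm
  let y : Coord (n + 1) := extChartAt (𝓡 (n + 1)) p p
  fderiv ℝ (fderiv ℝ F) y u v - fderiv ℝ F y (G.christoffel p u v)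

/-- The inverse `h^{αβ}` of the matrix `h_{αβ} = ⟨e_α, e_β⟩`. -/
def invGram {k : ℕ} {p : M} (e : Fin k → TangentSpace (𝓡 (n + 1)) p) :
    Matrix (Fin k) (Fin k) ℝ :=
  (Matrix.of fun α β ↦ G.inner p (e α) (e β))⁻¹

/-- The trace `h^{αβ} B(e_α, e_β)` of a scalar bilinear form `B`, where `e` is a basis of a
spacelike subspace. -/
def trace {k : ℕ} {p : M} (e : Fin k → TangentSpace (𝓡 (n + 1)) p)
    (B : TangentSpace (𝓡 (n + 1)) p → TangentSpace (𝓡 (n + 1)) p → ℝ) : ℝ :=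
  ∑ α, ∑ β, G.invGram e α β * B (e α) (e β)

/-- The component of `v` normal to the spacelike subspace with basis `e`,
`v - h^{αβ} ⟨v, e_α⟩ e_β`. -/
def normalPart {k : ℕ} {p : M} (e : Fin k → TangentSpace (𝓡 (n + 1)) p)
    (v : TangentSpace (𝓡 (n + 1)) p) : TangentSpace (𝓡 (n + 1)) p :=
  v - ∑ α, ∑ β, (G.invGram e α β * G.inner p v (e α)) • e β

section Submanifold

variable (k : ℕ) {S : Type*} [TopologicalSpace S] [ChartedSpace (Coord k) S] (Φ : S → M)

/-- `Φ` embeds the `k`-dimensional manifold `S` in `M` as a spacelike submanifold: it is a smooth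
embedding and the induced metric is positive definite. -/
def IsSpacelikeSubmanifold : Prop :=
  IsSmoothEmbedding (𝓡 k) (𝓡 (n + 1)) ∞ Φ ∧
    ∀ (s : S) (v : TangentSpace (𝓡 k) s), v ≠ 0 →
      0 < G.inner (Φ s) (mfderiv (𝓡 k) (𝓡 (n + 1)) Φ s v) (mfderiv (𝓡 k) (𝓡 (n + 1)) Φ s v)

/-- The coordinate tangent vectors `e_α = ∂Φ/∂u^α` of the submanifold at `Φ s`, where `u` are the
coordinates on `S` given by the chart at `s`. -/
def coordFrame (s : S) (α : Fin k) : TangentSpace (𝓡 (n + 1)) (Φ s) :=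
  let v : TangentSpace (𝓡 k) s := (EuclideanSpace.single α 1 : Coord k)
  mfderiv (𝓡 k) (𝓡 (n + 1)) Φ s v

/-- The covariant derivative `∇_{e_α} e_β = ∂_α ∂_β x + Γ(e_α, e_β)` at `Φ s`, where `x(u)` is the
expression of `Φ` in the coordinates given by the charts at `s` and at `Φ s`. -/
def covDerivFrame (s : S) (α β : Fin k) : TangentSpace (𝓡 (n + 1)) (Φ s) :=
  let x : Coord k → Coord (n + 1) :=
    extChartAt (𝓡 (n + 1)) (Φ s) ∘ Φ ∘ (extChartAt (𝓡 k) s).symm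
  let a : Coord (n + 1) :=
    fderiv ℝ (fderiv ℝ x) (extChartAt (𝓡 k) s s)
      (EuclideanSpace.single α 1) (EuclideanSpace.single β 1)
  a + G.christoffel (Φ s) (coordFrame k Φ s α) (coordFrame k Φ s β)

/-- The second fundamental form `II_{αβ} = -(∇_{e_α} e_β)^⊥`. -/
def secondFundamentalForm (s : S) (α β : Fin k) : TangentSpace (𝓡 (n + 1)) (Φ s) :=
  -G.normalPart (coordFrame k Φ s) (G.covDerivFrame k Φ s α β)

/-- The mean curvature vector `H = h^{αβ} II_{αβ}` at `Φ s`. -/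
def meanCurvature (s : S) : TangentSpace (𝓡 (n + 1)) (Φ s) :=
  ∑ α, ∑ β, G.invGram (coordFrame k Φ s) α β • G.secondFundamentalForm k Φ s α β

end Submanifold

end LorentzianMetric

/-- The structure of a spacetime on an `(n+1)`-dimensional smooth manifold `M`: a Lorentzian metric
and a time orientation, given by a continuous causal vector field. -/
structure Spacetime (n : ℕ) (M : Type*) [TopologicalSpace M]
    [ChartedSpace (Coord (n + 1)) M] [IsManifold (𝓡 (n + 1)) ∞ M]
    extends LorentzianMetric n M where
  /-- The vector field that selects the future half cones. -/
  orientation (p : M) : TangentSpace (𝓡 (n + 1)) p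
  orientation_causal (p : M) : toLorentzianMetric.IsCausal (orientation p)
  orientation_continuous :
    Continuous fun p ↦ (⟨p, orientation p⟩ : TangentBundle (𝓡 (n + 1)) M)

namespace Spacetime

variable {n : ℕ} {M : Type*} [TopologicalSpace M] [ChartedSpace (Coord (n + 1)) M]
  [IsManifold (𝓡 (n + 1)) ∞ M] (G : Spacetime n M)

/-- A causal vector is future if it lies in the same half cone as the orienting vector `o`. For
causal vectors `v`, `o` this means that `⟨v, o⟩ < 0` or that `v` is a positive multiple of `o` (the
latter matters only when `o` is null). -/
def IsFutureCausal {p : M} (v : TangentSpace (𝓡 (n + 1)) p) : Prop :=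
  G.IsCausal v ∧
    (G.inner p v (G.orientation p) < 0 ∨ ∃ c : ℝ, 0 < c ∧ v = c • G.orientation p)

/-- Future timelike vectors. -/
def IsFutureTimelike {p : M} (v : TangentSpace (𝓡 (n + 1)) p) : Prop :=
  G.IsTimelike v ∧ G.IsFutureCausal v

variable (k : ℕ) {S : Type*} [TopologicalSpace S] [ChartedSpace (Coord k) S] (Φ : S → M)

/-- The trapping condition at `Φ s`: the mean curvature vector is future timelike. -/
def TrappingCondition (s : S) : Prop :=
  G.IsFutureTimelike (G.meanCurvature k Φ s)

/-- A closed trapped submanifold: a nonempty compact spacelike submanifold that satisfies the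
trapping condition at all of its points. -/
def IsClosedTrappedSubmanifold : Prop :=
  Nonempty S ∧ CompactSpace S ∧ G.IsSpacelikeSubmanifold k Φ ∧ ∀ s, G.TrappingCondition k Φ s

end Spacetime

end

/-! This is a maximum principle. Along a spacelike submanifold, `∂_α ∂_β (g ∘ Φ) = ∇∇g(e_α, e_β) +
⟨∇g, ∇_{e_α} e_β⟩` (`fderiv_fderiv_comp_eq_hessian_add`). At a local maximum the left side is
negative semidefinite, so its trace against the positive definite `h^{αβ}` is nonpositive
(`Matrix.PosSemidef.sum_mul_nonpos`). There the tangent space also lies in `ker dg`, so the trace of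
the Hessian is nonnegative, and `∇g` is normal to the submanifold, so the trace of the last term is
`-⟨∇g, H⟩`. Hence `⟨∇g, H⟩ ≥ 0`. A future causal and a future timelike vector have negative product
(`inner_neg_of_isFutureCausal_of_isFutureTimelike`), so `H` is not future timelike. Compactness
supplies a maximum for the global statement. -/

/-! ### Second-order calculus in normed spaces. -/

/-- If the value were positive, the restriction of `f` to the line along `v` would have a local
minimum as well as a local maximum, hence be locally constant, with zero second derivative. -/
theorem fderiv_fderiv_apply_self_nonpos_of_isLocalMax {E : Type*} [NormedAddCommGroup E]
    [NormedSpace ℝ E] {f : E → ℝ} {x : E} (hf : ContDiffAt ℝ 2 f x) (hmax : IsLocalMax f x)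
    (v : E) : fderiv ℝ (fderiv ℝ f) x v v ≤ 0 := by
  by_contra! hpos
  set φ : ℝ → ℝ := fun t ↦ f (x + t • v) with hφ
  have hline : ∀ t : ℝ, HasDerivAt (fun t : ℝ ↦ x + t • v) v t := fun t ↦ by
    simpa using ((hasDerivAt_id t).smul_const v).const_add x
  have htend : Filter.Tendsto (fun t : ℝ ↦ x + t • v) (nhds 0) (nhds x) := by
    simpa using (hline 0).continuousAt.tendsto
  have hev : ∀ᶠ y in nhds x, DifferentiableAt ℝ f y := by
    filter_upwards [hf.eventually (by simp)] with y hy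
    exact hy.differentiableAt (by simp)
  have hderiv : deriv φ =ᶠ[nhds 0] fun t ↦ fderiv ℝ f (x + t • v) v := by
    filter_upwards [htend.eventually hev] with t ht
    exact (ht.hasFDerivAt.comp_hasDerivAt t (hline t)).deriv
  have hdiff : DifferentiableAt ℝ (fderiv ℝ f) x :=
    (hf.fderiv_right (m := 1) (by norm_num)).differentiableAt (by simp)
  have hsecond : deriv (deriv φ) 0 = fderiv ℝ (fderiv ℝ f) x v v := by
    rw [hderiv.deriv_eq]
    have h : HasFDerivAt (fderiv ℝ f) (fderiv ℝ (fderiv ℝ f) x) (x + (0 : ℝ) • v) := by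
      simpa using hdiff.hasFDerivAt
    have h' : HasDerivAt (fun t : ℝ ↦ fderiv ℝ f (x + t • v)) (fderiv ℝ (fderiv ℝ f) x v) 0 :=
      h.comp_hasDerivAt (0 : ℝ) (hline 0)
    simpa using (h'.clm_apply (hasDerivAt_const 0 v)).deriv
  have hmaxφ : IsLocalMax φ 0 := by
    filter_upwards [htend.eventually hmax] with t ht
    simpa [hφ] using ht
  have hminφ : IsLocalMin φ 0 := by
    refine isLocalMin_of_deriv_deriv_pos (hsecond ▸ hpos) hmaxφ.deriv_eq_zero ?_
    have : ContinuousAt f (x + (0 : ℝ) • v) := by simpa using hf.continuousAt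
    exact ContinuousAt.comp (f := fun t : ℝ ↦ x + t • v) this (hline 0).continuousAt
  have hconst : φ =ᶠ[nhds 0] fun _ ↦ φ 0 := by
    filter_upwards [hmaxφ, hminφ] with t h₁ h₂ using le_antisymm h₁ h₂
  have : deriv (deriv φ) 0 = 0 := by
    rw [hconst.deriv.deriv_eq]
    simp
  linarith

theorem fderiv_fderiv_comp_apply {E F : Type*} [NormedAddCommGroup E] [NormedSpace ℝ E]
    [NormedAddCommGroup F] [NormedSpace ℝ F] {f : F → ℝ} {x : E → F} {u : E}
    (hf : ContDiffAt ℝ 2 f (x u)) (hx : ContDiffAt ℝ 2 x u) (v w : E) :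
    fderiv ℝ (fderiv ℝ (f ∘ x)) u v w =
      fderiv ℝ (fderiv ℝ f) (x u) (fderiv ℝ x u v) (fderiv ℝ x u w) +
        fderiv ℝ f (x u) (fderiv ℝ (fderiv ℝ x) u v w) := by
  have hev : fderiv ℝ (f ∘ x) =ᶠ[nhds u] fun y ↦ (fderiv ℝ f (x y)).comp (fderiv ℝ x y) := by
    filter_upwards [hx.eventually (by simp), hx.continuousAt.eventually (hf.eventually (by simp))]
      with y hxy hfy
    exact fderiv_comp y (hfy.differentiableAt (by simp)) (hxy.differentiableAt (by simp))
  have hf' : DifferentiableAt ℝ (fderiv ℝ f) (x u) :=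
    (hf.fderiv_right (m := 1) (by norm_num)).differentiableAt (by simp)
  have hx' : DifferentiableAt ℝ (fderiv ℝ x) u :=
    (hx.fderiv_right (m := 1) (by norm_num)).differentiableAt (by simp)
  have h := (hf'.hasFDerivAt.comp u (hx.differentiableAt (by simp)).hasFDerivAt).clm_comp
    hx'.hasFDerivAt
  rw [hev.fderiv_eq]
  erw [h.fderiv]
  simp [add_comm]

/-! ### Causal vectors in Lorentzian linear algebra. -/

namespace LorentzianMetric

variable {n : ℕ} {M : Type*} [TopologicalSpace M] [ChartedSpace (Coord (n + 1)) M]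
  [IsManifold (𝓡 (n + 1)) ∞ M] (G : LorentzianMetric n M)

/-- In an orthonormal basis, orthogonality equates `w₀ h₀` with the Euclidean product of the spatial
parts. Cauchy–Schwarz and `|h_spatial|² < h₀²` then give `w₀² < |w_spatial|²`. -/
theorem inner_self_pos_of_inner_timelike_eq_zero {p : M} {h w : TangentSpace (𝓡 (n + 1)) p}
    (hh : G.IsTimelike h) (hw : w ≠ 0) (hwh : G.inner p w h = 0) : 0 < G.inner p w w := by
  obtain ⟨b, hb⟩ := G.signature p
  have key : ∀ v w : TangentSpace (𝓡 (n + 1)) p, G.inner p v w =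
      -(b.repr v 0 * b.repr w 0) + ∑ i : Fin n, b.repr v i.succ * b.repr w i.succ := by
    intro v w
    conv_lhs => rw [← b.sum_repr v, ← b.sum_repr w]
    simp only [map_sum, map_smul, sum_apply, smul_apply, hb, smul_eq_mul, mul_ite, mul_zero,
      Finset.sum_ite_eq', Finset.mem_univ, if_true]
    simp [Fin.sum_univ_succ, Fin.succ_ne_zero, mul_comm]
  unfold IsTimelike at hh
  rw [key] at hh hwh ⊢
  have hcs := Finset.sum_mul_sq_le_sq_mul_sq Finset.univ
    (fun i : Fin n ↦ b.repr w i.succ) (fun i : Fin n ↦ b.repr h i.succ)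
  simp only [← pow_two] at hh ⊢
  set W := ∑ i : Fin n, b.repr w i.succ ^ 2 with hW
  set K := ∑ i : Fin n, b.repr h i.succ ^ 2
  have hKn : 0 ≤ K := Finset.sum_nonneg fun i _ ↦ sq_nonneg _
  have hWn : 0 ≤ W := Finset.sum_nonneg fun i _ ↦ sq_nonneg _
  have hsum : ∑ i : Fin n, b.repr w i.succ * b.repr h i.succ = b.repr w 0 * b.repr h 0 := by
    linarith
  rw [hsum, mul_pow] at hcs
  have hh0 : 0 < b.repr h 0 ^ 2 := by linarith
  -- The strict inequality needs a nonzero spatial part; if that part vanishes, Cauchy–Schwarz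
  -- forces `w₀ = 0` too.
  rcases hWn.eq_or_lt with hW0 | hWpos
  · refine absurd ?_ hw
    have hw0 : b.repr w 0 = 0 := by
      rw [← hW0, zero_mul] at hcs
      have : b.repr w 0 ^ 2 ≤ 0 := nonpos_of_mul_nonpos_left hcs hh0
      exact pow_eq_zero_iff two_ne_zero |>.1 (le_antisymm this (sq_nonneg _))
    have hws : ∀ i : Fin n, b.repr w i.succ = 0 := fun i ↦ by
      have := (Finset.sum_eq_zero_iff_of_nonneg fun i _ ↦ sq_nonneg _).1 (hW.symm.trans hW0.symm) i
        (Finset.mem_univ i)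
      exact pow_eq_zero_iff two_ne_zero |>.1 this
    refine b.ext_elem fun i ↦ ?_
    refine Fin.cases ?_ (fun i ↦ ?_) i <;> simp [hw0, hws]
  · have : b.repr w 0 ^ 2 < W := by
      refine lt_of_mul_lt_mul_right (hcs.trans_lt ?_) hh0.le
      exact mul_lt_mul_of_pos_left (by linarith) hWpos
    linarith

end LorentzianMetric

/-- The two vectors are related only through the orienting vector `o`. The main case tests the
combination `⟨v, h⟩ o - ⟨h, o⟩ v`, which is orthogonal to the timelike `h` and so must be spacelike
or zero. The other cases have `v` or `h` a positive multiple of `o`. -/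
theorem Spacetime.inner_neg_of_isFutureCausal_of_isFutureTimelike {n : ℕ} {M : Type*}
    [TopologicalSpace M] [ChartedSpace (Coord (n + 1)) M] [IsManifold (𝓡 (n + 1)) ∞ M]
    (G : Spacetime n M) {p : M} {v h : TangentSpace (𝓡 (n + 1)) p}
    (hv : G.IsFutureCausal v) (hh : G.IsFutureTimelike h) : G.inner p v h < 0 := by
  obtain ⟨hT, -, hho⟩ := hh
  obtain ⟨⟨hv0, hvv⟩, hvo⟩ := hv
  obtain ⟨-, hoo⟩ := G.orientation_causal p
  set o := G.orientation p
  rcases hho with hho | ⟨c, hc, rfl⟩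
  · rcases hvo with hvo | ⟨c, hc, rfl⟩
    · by_contra! hvh
      set a := G.inner p v h
      set d := G.inner p h o with hd
      have hwh : G.inner p (a • o + (-d) • v) h = 0 := by
        have := G.symm p o h
        simp only [map_add, map_smul, add_apply, smul_apply, smul_eq_mul, this]
        change a * d + -d * a = 0
        ring
      have hww : G.inner p (a • o + (-d) • v) (a • o + (-d) • v) =
          a ^ 2 * G.inner p o o + 2 * (a * -d * G.inner p v o) + d ^ 2 * G.inner p v v := by
        have := G.symm p o v
        simp only [map_add, map_smul, add_apply, smul_apply, smul_eq_mul, this]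
        ring
      -- With `a ≥ 0` and `d < 0`, each of the three terms of `hww` is nonpositive, so the
      -- combination can only be zero.
      have had : 0 ≤ a * -d := mul_nonneg hvh (by linarith)
      have h₁ := mul_nonpos_of_nonneg_of_nonpos (sq_nonneg a) hoo
      have h₂ := mul_nonpos_of_nonneg_of_nonpos had hvo.le
      have h₃ := mul_nonpos_of_nonneg_of_nonpos (sq_nonneg d) hvv
      by_cases hw : a • o + (-d) • v = 0
      · rw [hw] at hww
        simp only [map_zero] at hww
        have h₄ : a * -d * G.inner p v o = 0 := by linarith
        have ha : a = 0 := by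
          rcases mul_eq_zero.1 h₄ with h | h
          · rcases mul_eq_zero.1 h with h | h <;> linarith
          · linarith
        rw [ha, zero_smul, zero_add] at hw
        rcases smul_eq_zero.1 hw with h | h
        · linarith
        · exact hv0 h
      · have := G.inner_self_pos_of_inner_timelike_eq_zero hT hw hwh
        linarith
    · rw [map_smul, smul_apply, G.symm, smul_eq_mul]
      exact mul_neg_of_pos_of_neg hc hho
  · have hTo : G.inner p o o < 0 := by
      have : G.inner p (c • o) (c • o) < 0 := hT
      simp only [map_smul, smul_apply, smul_eq_mul] at this
      exact (pos_iff_neg_of_mul_neg ((mul_assoc c c _).symm ▸ this)).1 (mul_pos hc hc)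
    rw [map_smul, smul_eq_mul]
    refine mul_neg_of_pos_of_neg hc ?_
    rcases hvo with hvo | ⟨d, hd, rfl⟩
    · exact hvo
    · rw [map_smul, smul_apply, smul_eq_mul]
      exact mul_neg_of_pos_of_neg hd hTo

/-! ### Traces, mean curvature and the Hessian along a submanifold. -/

/-- Writing `P` as a sum of rank-one matrices `v vᵀ` turns the trace into a sum of values `B w w`.
-/
theorem Matrix.PosSemidef.sum_mul_nonpos {ι E : Type*} [Fintype ι] [NormedAddCommGroup E]
    [NormedSpace ℝ E] {P : Matrix ι ι ℝ} (hP : P.PosSemidef) {B : E →L[ℝ] E →L[ℝ] ℝ}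
    (hB : ∀ v, B v v ≤ 0) (e : ι → E) : ∑ i, ∑ j, P i j * B (e i) (e j) ≤ 0 := by
  classical
  obtain ⟨m, v, rfl⟩ := Matrix.posSemidef_iff_eq_sum_vecMulVec.1 hP
  have : ∑ i, ∑ j, (∑ l, Matrix.vecMulVec (v l) (star (v l))) i j * B (e i) (e j) =
      ∑ l, B (∑ i, v l i • e i) (∑ i, v l i • e i) := by
    simp only [map_sum, map_smul, smul_eq_mul, Matrix.sum_apply,
      Matrix.vecMulVec_apply, star_trivial, Finset.sum_mul]
    rw [Finset.sum_comm_cycle]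
    refine Finset.sum_congr rfl fun l _ ↦ ?_
    rw [Finset.sum_comm]
    refine Finset.sum_congr rfl fun i _ ↦ ?_
    rw [_root_.sum_apply, Finset.mul_sum]
    simp only [_root_.smul_apply, smul_eq_mul, mul_assoc, mul_left_comm]
  rw [this]
  exact Finset.sum_nonpos fun l _ ↦ hB _

namespace LorentzianMetric

variable {n : ℕ} {M : Type*} [TopologicalSpace M] [ChartedSpace (Coord (n + 1)) M]
  [IsManifold (𝓡 (n + 1)) ∞ M] (G : LorentzianMetric n M)

theorem posDef_invGram {k : ℕ} {p : M} {e : Fin k → TangentSpace (𝓡 (n + 1)) p}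
    (he : ∀ x : Fin k → ℝ, x ≠ 0 → 0 < G.inner p (∑ i, x i • e i) (∑ i, x i • e i)) :
    (G.invGram e).PosDef := by
  refine Matrix.PosDef.inv (Matrix.PosDef.of_dotProduct_mulVec_pos ?_ fun x hx ↦ ?_)
  · ext i j
    exact G.symm p _ _
  · refine (he x hx).trans_eq (Eq.symm ?_)
    change ∑ i, x i * ∑ j, G.inner p (e i) (e j) * x j = _
    rw [map_sum]
    refine Finset.sum_congr rfl fun i _ ↦ ?_
    rw [map_smul, G.symm, map_sum, smul_eq_mul]
    simp only [map_smul, smul_eq_mul, mul_comm]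

theorem inner_normalPart {k : ℕ} {p : M} {e : Fin k → TangentSpace (𝓡 (n + 1)) p}
    {u : TangentSpace (𝓡 (n + 1)) p} (hu : ∀ α, G.inner p u (e α) = 0)
    (v : TangentSpace (𝓡 (n + 1)) p) : G.inner p u (G.normalPart e v) = G.inner p u v := by
  simp [normalPart, hu]

variable {k : ℕ} {S : Type*} [TopologicalSpace S] [ChartedSpace (Coord k) S] {Φ : S → M}

theorem inner_meanCurvature {s : S} {u : TangentSpace (𝓡 (n + 1)) (Φ s)}
    (hu : ∀ α, G.inner (Φ s) u (coordFrame k Φ s α) = 0) :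
    G.inner (Φ s) u (G.meanCurvature k Φ s) = -∑ α, ∑ β, G.invGram (coordFrame k Φ s) α β *
      G.inner (Φ s) u (G.covDerivFrame k Φ s α β) := by
  simp [meanCurvature, secondFundamentalForm, G.inner_normalPart hu]

theorem inner_gradient (g : M → ℝ) (p : M) (w : TangentSpace (𝓡 (n + 1)) p) :
    G.inner p (G.gradient g p) w = mfderiv (𝓡 (n + 1)) 𝓘(ℝ, ℝ) g p w :=
  G.inner_sharp p _ w

/-- The chain rule gives `∂∂F(e_α, e_β) + dF(∂_α ∂_β x)`; the Christoffel terms in the Hessian and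
in the covariant derivative cancel. -/
theorem fderiv_fderiv_comp_eq_hessian_add {g : M → ℝ} {s : S}
    (hg : ContMDiffAt (𝓡 (n + 1)) 𝓘(ℝ, ℝ) 2 g (Φ s))
    (hΦ : ContMDiffAt (𝓡 k) (𝓡 (n + 1)) 2 Φ s) (α β : Fin k) :
    ContDiffAt ℝ 2 (g ∘ Φ ∘ (extChartAt (𝓡 k) s).symm) (extChartAt (𝓡 k) s s) ∧
    fderiv ℝ (fderiv ℝ (g ∘ Φ ∘ (extChartAt (𝓡 k) s).symm)) (extChartAt (𝓡 k) s s)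
      (EuclideanSpace.single α 1) (EuclideanSpace.single β 1) =
      G.hessian g (Φ s) (coordFrame k Φ s α) (coordFrame k Φ s β) +
        G.inner (Φ s) (G.gradient g (Φ s)) (G.covDerivFrame k Φ s α β) := by
  set x : Coord k → Coord (n + 1) :=
    extChartAt (𝓡 (n + 1)) (Φ s) ∘ Φ ∘ (extChartAt (𝓡 k) s).symm with hx
  set F : Coord (n + 1) → ℝ := g ∘ (extChartAt (𝓡 (n + 1)) (Φ s)).symm with hF
  set u := extChartAt (𝓡 k) s s with hu
  have hxu : x u = extChartAt (𝓡 (n + 1)) (Φ s) (Φ s) := by simp [hx, hu]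
  have hxC : ContDiffAt ℝ 2 x u := by
    have := (contMDiffAt_iff.1 hΦ).2
    rwa [ModelWithCorners.range_eq_univ, contDiffWithinAt_univ] at this
  have hFC : ContDiffAt ℝ 2 F (x u) := by
    have := (contMDiffAt_iff.1 hg).2
    rwa [ModelWithCorners.range_eq_univ, contDiffWithinAt_univ, ← hxu] at this
  -- The equality is only local, since the chart at `Φ s` need not cover the image of `Φ`.
  have hcomp : g ∘ Φ ∘ (extChartAt (𝓡 k) s).symm =ᶠ[nhds u] F ∘ x := by
    have hcont : ContinuousAt (Φ ∘ (extChartAt (𝓡 k) s).symm) u := by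
      refine ContinuousAt.comp ?_ (continuousAt_extChartAt_symm s)
      simpa [hu] using hΦ.continuousAt
    have := hcont.preimage_mem_nhds (t := (extChartAt (𝓡 (n + 1)) (Φ s)).source)
      (by simpa [hu] using extChartAt_source_mem_nhds (I := 𝓡 (n + 1)) (Φ s))
    filter_upwards [this] with y hy
    simp only [hF, hx, Function.comp_apply]
    exact congrArg g ((extChartAt (𝓡 (n + 1)) (Φ s)).left_inv hy).symm
  have hdx : ∀ γ, coordFrame k Φ s γ = fderiv ℝ x u (EuclideanSpace.single γ 1) := fun γ ↦ by
    simp only [coordFrame]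
    rw [(hΦ.mdifferentiableAt (by simp)).mfderiv, ModelWithCorners.range_eq_univ,
      fderivWithin_univ]
    rfl
  have hdF' : mfderiv (𝓡 (n + 1)) 𝓘(ℝ, ℝ) g (Φ s) = fderiv ℝ F (x u) := by
    rw [(hg.mdifferentiableAt (by simp)).mfderiv, hxu, ModelWithCorners.range_eq_univ,
      fderivWithin_univ]
    rfl
  have hdF : ∀ w, G.inner (Φ s) (G.gradient g (Φ s)) w = fderiv ℝ F (x u) w := fun w ↦ by
    rw [inner_gradient]
    exact congrArg (· w) hdF'
  refine ⟨(hFC.comp u hxC).congr_of_eventuallyEq hcomp, ?_⟩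
  rw [hcomp.fderiv.fderiv_eq, fderiv_fderiv_comp_apply hFC hxC, hdF]
  simp only [hessian, covDerivFrame, ← hx, ← hF, ← hu, ← hxu]
  rw [hdx, hdx]
  erw [map_add]
  ring

theorem IsSpacelikeSubmanifold.inner_sum_coordFrame_pos (hΦ : G.IsSpacelikeSubmanifold k Φ) (s : S)
    {x : Fin k → ℝ} (hx : x ≠ 0) :
    0 < G.inner (Φ s) (∑ i, x i • coordFrame k Φ s i) (∑ i, x i • coordFrame k Φ s i) := by
  set v : Coord k := ∑ i, x i • EuclideanSpace.single i 1 with hv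
  have hxv : ∀ i, v i = x i := fun i ↦ by
    simp [hv, Finset.sum_apply, Pi.single_apply]
  have hv0 : v ≠ 0 := fun h ↦ hx (funext fun i ↦ by rw [← hxv, h]; rfl)
  have hsum : ∑ i, x i • coordFrame k Φ s i =
      mfderiv (𝓡 k) (𝓡 (n + 1)) Φ s (show TangentSpace (𝓡 k) s from v) := by
    rw [hv]
    simp only [coordFrame]
    erw [map_sum]
    refine Finset.sum_congr rfl fun i _ ↦ ?_
    erw [map_smul]
  rw [hsum]
  exact hΦ.2 s v hv0

theorem linearIndependent_of_inner_sum_pos {p : M} {e : Fin k → TangentSpace (𝓡 (n + 1)) p}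
    (he : ∀ x : Fin k → ℝ, x ≠ 0 → 0 < G.inner p (∑ i, x i • e i) (∑ i, x i • e i)) :
    LinearIndependent ℝ e := by
  rw [Fintype.linearIndependent_iff]
  intro x hx
  by_contra! h
  have := he x fun h0 ↦ by simp [h0] at h
  rw [hx] at this
  simp at this

theorem isSpacelike_span_range {p : M} {e : Fin k → TangentSpace (𝓡 (n + 1)) p}
    (he : ∀ x : Fin k → ℝ, x ≠ 0 → 0 < G.inner p (∑ i, x i • e i) (∑ i, x i • e i)) :
    G.IsSpacelike (Submodule.span ℝ (Set.range e)) := by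
  intro v hv hv0
  obtain ⟨x, rfl⟩ := (Submodule.mem_span_range_iff_exists_fun ℝ).1 hv
  refine he x fun h ↦ hv0 ?_
  simp [h]

end LorentzianMetric

/-! ### The maximum principle and the theorem. -/

theorem Spacetime.not_trappingCondition_of_isLocalMax {n k : ℕ} {M : Type*} [TopologicalSpace M]
    [ChartedSpace (Coord (n + 1)) M] [IsManifold (𝓡 (n + 1)) ∞ M] (G : Spacetime n M)
    {g : M → ℝ} {S : Type*} [TopologicalSpace S] [ChartedSpace (Coord k) S] {Φ : S → M}
    (hΦ : G.IsSpacelikeSubmanifold k Φ) {s : S}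
    (hg : ContMDiffAt (𝓡 (n + 1)) 𝓘(ℝ, ℝ) 2 g (Φ s))
    (hgrad : G.IsFutureCausal (G.gradient g (Φ s)))
    (htrace : ∀ W : Submodule ℝ (TangentSpace (𝓡 (n + 1)) (Φ s)),
      (∀ v ∈ W, mfderiv (𝓡 (n + 1)) 𝓘(ℝ, ℝ) g (Φ s) v = 0) → G.IsSpacelike W →
      ∀ b : Module.Basis (Fin k) ℝ W,
        0 ≤ G.trace (fun α ↦ (b α : TangentSpace (𝓡 (n + 1)) (Φ s))) (G.hessian g (Φ s)))
    (hmax : IsLocalMax (g ∘ Φ) s) : ¬ G.TrappingCondition k Φ s := by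
  intro htrap
  have hneg : G.inner (Φ s) (G.gradient g (Φ s)) (G.meanCurvature k Φ s) < 0 :=
    G.inner_neg_of_isFutureCausal_of_isFutureTimelike hgrad htrap
  set e := LorentzianMetric.coordFrame (n := n) k Φ s with he
  have hpos := fun (x : Fin k → ℝ) (hx : x ≠ 0) ↦
    hΦ.inner_sum_coordFrame_pos G.toLorentzianMetric s hx
  have hΦ2 : ContMDiffAt (𝓡 k) (𝓡 (n + 1)) 2 Φ s :=
    (hΦ.1.contMDiff s).of_le (WithTop.coe_le_coe.2 (le_top : (2 : ℕ∞) ≤ ⊤))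
  set f := g ∘ Φ ∘ (extChartAt (𝓡 k) s).symm with hf
  set u := extChartAt (𝓡 k) s s with hu
  have hfmax : IsLocalMax f u := by
    have h : Filter.Tendsto (extChartAt (𝓡 k) s).symm (nhds u) (nhds s) := by
      simpa [hu] using (continuousAt_extChartAt_symm (I := 𝓡 k) s).tendsto
    filter_upwards [h.eventually hmax] with y hy
    simpa [hf, hu] using hy
  have hde : ∀ v : TangentSpace (𝓡 k) s, mfderiv (𝓡 (n + 1)) 𝓘(ℝ, ℝ) g (Φ s)
      (mfderiv (𝓡 k) (𝓡 (n + 1)) Φ s v) = 0 := fun v ↦ by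
    have hgd := hg.mdifferentiableAt (by simp)
    have hΦd := hΦ2.mdifferentiableAt (by simp)
    have h := mfderiv_comp s hgd hΦd
    have h0 : mfderiv (𝓡 k) 𝓘(ℝ, ℝ) (g ∘ Φ) s = 0 := by
      rw [(hgd.comp s hΦd).mfderiv, ModelWithCorners.range_eq_univ, fderivWithin_univ]
      exact hfmax.fderiv_eq_zero
    rw [h0] at h
    exact (congrArg (· v) h).symm
  have hsecond : ∑ α, ∑ β, G.invGram e α β * fderiv ℝ (fderiv ℝ f) u
      (EuclideanSpace.single α 1) (EuclideanSpace.single β 1) ≤ 0 := by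
    -- For `k = 0` the sum is empty; otherwise an index is needed only to extract the regularity of
    -- `f` from the Hessian lemma.
    rcases isEmpty_or_nonempty (Fin k) with hk | ⟨⟨i⟩⟩
    · simp
    · exact (G.posDef_invGram hpos).posSemidef.sum_mul_nonpos
        (fun v ↦ fderiv_fderiv_apply_self_nonpos_of_isLocalMax
          (G.fderiv_fderiv_comp_eq_hessian_add hg hΦ2 i i).1 hfmax v) _
  -- The hypothesis is applied to the tangent space of the submanifold, with the coordinate frame as
  -- basis; that it lies in `ker dg` follows from `hde`.
  have htr := htrace _ ?_ (G.isSpacelike_span_range hpos)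
    (Module.Basis.span (G.linearIndependent_of_inner_sum_pos hpos))
  · have hb : (fun α ↦ (Module.Basis.span (G.linearIndependent_of_inner_sum_pos hpos) α :
        TangentSpace (𝓡 (n + 1)) (Φ s))) = e :=
      funext fun α ↦ congrArg Subtype.val (Module.Basis.span_apply _ α)
    rw [hb] at htr
    rw [G.inner_meanCurvature fun α ↦ (G.inner_gradient g (Φ s) _).trans (hde _)] at hneg
    have hH : ∀ α β, fderiv ℝ (fderiv ℝ f) u (EuclideanSpace.single α 1)
        (EuclideanSpace.single β 1) = G.hessian g (Φ s) (e α) (e β) +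
          G.inner (Φ s) (G.gradient g (Φ s)) (G.covDerivFrame k Φ s α β) := fun α β ↦
      (G.fderiv_fderiv_comp_eq_hessian_add hg hΦ2 α β).2
    simp only [hH, mul_add, Finset.sum_add_distrib] at hsecond
    unfold LorentzianMetric.trace at htr
    linarith
  · intro v hv
    obtain ⟨x, rfl⟩ := (Submodule.mem_span_range_iff_exists_fun ℝ).1 hv
    rw [map_sum]
    refine Finset.sum_eq_zero fun i _ ↦ ?_
    rw [map_smul]
    erw [hde]
    exact smul_zero _

theorem theorem1 (n k : ℕ) (hn : 2 ≤ n) {M : Type*} [TopologicalSpace M]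
    [ChartedSpace (Coord (n + 1)) M] [IsManifold (𝓡 (n + 1)) ∞ M] (G : Spacetime n M)
    (g : M → ℝ) (hg : ContMDiff (𝓡 (n + 1)) 𝓘(ℝ, ℝ) 2 g)
    (Z : Set M) (hZ : IsOpen Z)
    (hgrad : ∀ p ∈ Z, G.IsFutureCausal (G.gradient g p))
    (htrace : ∀ p ∈ Z, ∀ W : Submodule ℝ (TangentSpace (𝓡 (n + 1)) p),
      (∀ v ∈ W, mfderiv (𝓡 (n + 1)) 𝓘(ℝ, ℝ) g p v = 0) → G.IsSpacelike W →
      ∀ b : Module.Basis (Fin k) ℝ W,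
        0 ≤ G.trace (fun α ↦ (b α : TangentSpace (𝓡 (n + 1)) p)) (G.hessian g p)) :
    (∀ (S : Type*) [TopologicalSpace S] [ChartedSpace (Coord k) S] [IsManifold (𝓡 k) ∞ S]
      (Φ : S → M), G.IsSpacelikeSubmanifold k Φ →
      ∀ s : S, Φ s ∈ Z → IsLocalMax (g ∘ Φ) s → ¬ G.TrappingCondition k Φ s) ∧
    (∀ (S : Type*) [TopologicalSpace S] [ChartedSpace (Coord k) S] [IsManifold (𝓡 k) ∞ S]
      (Φ : S → M), G.IsClosedTrappedSubmanifold k Φ → ¬ Set.range Φ ⊆ Z) := by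
  refine ⟨fun S _ _ _ Φ hΦ s hs hmax ↦ G.not_trappingCondition_of_isLocalMax hΦ hg.contMDiffAt
    (hgrad _ hs) (htrace _ hs) hmax, fun S _ _ _ Φ hΦ hsub ↦ ?_⟩
  obtain ⟨_, _, hsp, htrap⟩ := hΦ
  obtain ⟨s, -, hs⟩ := isCompact_univ.exists_isMaxOn Set.univ_nonempty
    (hg.continuous.comp hsp.1.isEmbedding.continuous).continuousOn
  have hsZ := hsub (Set.mem_range_self s)
  exact G.not_trappingCondition_of_isLocalMax hsp hg.contMDiffAt (hgrad _ hsZ) (htrace _ hsZ)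
    (Filter.Eventually.of_forall fun y ↦ hs (Set.mem_univ y)) (htrap s)
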